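/- Let $(X(j,k))_{j,k\ge 1}$ and $(Y(j,k))_{j,k\ge 1}$ be jointly independent standard normal $\mathcal N(0,1)$ real random variables. For $n\ge 1$ let $A_n$ be the complex Ginibre matrix, i.e. the $n\times n$ matrix with entries $$a_n(j,k)=\frac{X(j,k)+iY(j,k)}{\sqrt{2n}},\qquad 1\le j,k\le n,$$ and let $A_n^*$ be its conjugate transpose. Let $k$ be a positive integer, let $\mathbf p=(p(1),\dots,p(k))$ and $\mathbf q=(q(1),\dots,q(k))$ be tuples of nonnegative integers, and put $$M_n(\mathbf p,\mathbf q)=\frac1n\operatorname{tr}\bigl[A_n^{p(1)}(A_n^*)^{q(1)}\cdots A_n^{p(k)}(A_n^*)^{q(k)}\bigr].$$ Then $M_n(\mathbf p,\mathbf q)$ is integrable for every $n$, and $$\lim_{n\to\infty}\mathbb E\bigl[M_n(\mathbf p,\mathbf q)\bigr]=m(\mathbf p,\mathbf q),$$ where $m(\mathbf p,\mathbf q)$ is the following number. Let $R=p(1)+\dots+p(k)+q(1)+\dots+q(k)$, place $R$ vertices in cyclic order on a circle, and assign to them, in this order, the spins $$\sigma_{\mathbf p,\mathbf q}=\bigl((+1)^{p(1)},(-1)^{q(1)},\dots,(+1)^{p(k)},(-1)^{q(k)}\bigr)\in\{+1,-1\}^R,$$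 where $(\pm1)^{r}$ denotes $r$ consecutive entries $\pm1$. Then $m(\mathbf p,\mathbf q)$ is the number of non-crossing perfect matchings of the $R$ vertices (no two edges cross when drawn as chords) in which every edge joins a vertex of spin $+1$ to a vertex of spin $-1$. (For $R=0$ the empty matching is counted, so $m=1$.) -/

import Mathlib

open MeasureTheory ProbabilityTheory Filter Topology Matrix

namespace Ginibre

/-- The `n × n` matrix with entries `a_n(j,k) = (x(j,k) + i y(j,k)) / √(2n)`, built from the
upper left corners of two infinite real arrays (indexed from `0`). -/
noncomputable def ginibreMatrix (x y : ℕ → ℕ → ℝ) (n : ℕ) : Matrix (Fin n) (Fin n) ℂ :=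
  Matrix.of fun j k => ((x j k : ℂ) + Complex.I * (y j k : ℂ)) / ((Real.sqrt (2 * n) : ℝ) : ℂ)

/-- The normalized mixed trace `(1/n) tr [A^{p(1)} (A^*)^{q(1)} ⋯ A^{p(k)} (A^*)^{q(k)}]`,
the factors being multiplied from left to right. -/
noncomputable def mixedTrace {n k : ℕ} (A : Matrix (Fin n) (Fin n) ℂ) (p q : Fin k → ℕ) : ℂ :=
  (1 / (n : ℂ)) * Matrix.trace (List.ofFn fun j => A ^ p j * Aᴴ ^ q j).prod

/-- `X(j,k), Y(j,k)`, for all `j, k`, form one family of jointly independent standard normal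
real random variables. -/
structure IsIIDStandardGaussian {Ω : Type*} [MeasurableSpace Ω] (X Y : ℕ → ℕ → Ω → ℝ)
    (μ : Measure Ω) : Prop where
  law_X : ∀ j k, HasLaw (X j k) (gaussianReal 0 1) μ
  law_Y : ∀ j k, HasLaw (Y j k) (gaussianReal 0 1) μ
  indep : iIndepFun
    (Sum.elim (fun s : ℕ × ℕ => X s.1 s.2) (fun s : ℕ × ℕ => Y s.1 s.2)) μ

/-- The spin pattern `((+1)^{p(1)}, (-1)^{q(1)}, …, (+1)^{p(k)}, (-1)^{q(k)})`. -/
def spins {k : ℕ} (p q : Fin k → ℕ) : List ℤ :=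
  (List.ofFn fun j => List.replicate (p j) (1 : ℤ) ++ List.replicate (q j) (-1 : ℤ)).flatten

/-- The number of vertices is `R = p(1) + ⋯ + p(k) + q(1) + ⋯ + q(k)`. -/
theorem length_spins {k : ℕ} (p q : Fin k → ℕ) :
    (spins p q).length = ∑ j, p j + ∑ j, q j := by
  simp [spins, List.length_flatten, List.map_ofFn, List.sum_ofFn, Finset.sum_add_distrib,
    Function.comp_def]

/-- A (perfect) matching of `R` vertices, given by the map `f` that sends each vertex to the
other endpoint of its edge. -/
def IsMatching {R : ℕ} (f : Fin R → Fin R) : Prop :=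
  ∀ i, f i ≠ i ∧ f (f i) = i

/-- The vertices are placed in cyclic order on a circle. No two edges of the matching cross as
chords: there is no pair of edges `{i, f i}`, `{j, f j}` with `i < j < f i < f j`. -/
def IsNonCrossing {R : ℕ} (f : Fin R → Fin R) : Prop :=
  ∀ i j, ¬ (i < j ∧ j < f i ∧ f i < f j)

/-- Each edge has one endpoint of spin `+1` and one endpoint of spin `-1`. -/
def JoinsOppositeSpins {R : ℕ} (σ : Fin R → ℤ) (f : Fin R → Fin R) : Prop :=
  ∀ i, (σ i = 1 ∧ σ (f i) = -1) ∨ (σ i = -1 ∧ σ (f i) = 1)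

/-- The number of non-crossing matchings of the `R` vertices on a circle with spins given by
the pattern of `p, q`, such that every edge joins a `+1` spin to a `-1` spin. -/
noncomputable def limitMoment {k : ℕ} (p q : Fin k → ℕ) : ℕ :=
  Nat.card {f : Fin (spins p q).length → Fin (spins p q).length //
    IsMatching f ∧ IsNonCrossing f ∧ JoinsOppositeSpins (spins p q).get f}

end Ginibre

/-! Encode `A` and `Aᴴ` as letters and study the expectations of all products of normalized traces
of words. Gaussian integration by parts (`polyExpectation_X_mul`) in the first letter pairs it with
every opposite letter. A partner in the same word `w = u ++ [!s] ++ v` splits that trace into the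
traces of `u` and `v`. A partner in another word merges two traces, at a cost of `1/n²`. This is
`IsGinibreFunctional.schwinger_dyson`, exact for each `n`.

In the limit the merging terms vanish, and induction on size (`tendsto_of_recursion`) shows that
expectations of products converge to products of numbers `m` with `m (s :: w) = ∑ m u * m v`.
Carrying products of traces through the induction makes any variance estimate unnecessary.
Non-crossing matchings obey the same recursion (`wordMatchings_cons`): the edge at the first vertex
separates the remaining vertices into two independent sides. -/

namespace Ginibre

/-! ### Gaussian integration by parts for polynomials -/

section Gaussian

/-- The `k`-th moment of the standard normal distribution. -/
noncomputable def gaussianMoment (k : ℕ) : ℝ := ∫ x, x ^ k ∂(gaussianReal 0 1)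

lemma integrable_pow_gaussianReal (k : ℕ) : Integrable (fun x : ℝ => x ^ k) (gaussianReal 0 1) := by
  have h := (memLp_id_gaussianReal (μ := 0) (v := 1) (k : NNReal)).integrable_norm_pow'
  refine (integrable_norm_iff (by fun_prop)).1 ?_
  simpa [norm_pow] using h

lemma integrable_gaussianPDFReal_mul_pow (k : ℕ) :
    Integrable (fun x : ℝ => gaussianPDFReal 0 1 x * x ^ k) := by
  have h := integrable_pow_gaussianReal k
  rw [gaussianReal_of_var_ne_zero _ one_ne_zero, integrable_withDensity_iff_integrable_smul'
    (measurable_gaussianPDF _ _) (ae_of_all _ fun _ ↦ gaussianPDF_lt_top)] at h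
  simpa [toReal_gaussianPDF] using h

lemma gaussianMoment_eq (k : ℕ) :
    gaussianMoment k = ∫ x, gaussianPDFReal 0 1 x * x ^ k := by
  simp [gaussianMoment, integral_gaussianReal_eq_integral_smul one_ne_zero]

lemma hasDerivAt_gaussianPDFReal (x : ℝ) :
    HasDerivAt (gaussianPDFReal 0 1) (-x * gaussianPDFReal 0 1 x) x := by
  have h : HasDerivAt (fun y : ℝ => -(y - 0) ^ 2 / (2 * ((1 : NNReal) : ℝ))) (-x) x := by
    have := ((hasDerivAt_id x).pow 2).neg.div_const 2
    simp only [sub_zero, NNReal.coe_one, mul_one]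
    convert! this using 1
    simp; ring
  have := h.exp.const_mul ((√(2 * Real.pi * ((1 : NNReal) : ℝ)))⁻¹)
  convert! this using 1
  simp only [gaussianPDFReal]
  ring

@[simp] lemma gaussianMoment_zero : gaussianMoment 0 = 1 := by simp [gaussianMoment]

/-- The derivative of `x ^ k` times the density integrates to zero. At `k = 0` the truncated `k - 1`
is harmless because of the factor `k`. -/
lemma gaussianMoment_succ (k : ℕ) :
    gaussianMoment (k + 1) = k * gaussianMoment (k - 1) := by
  have hd (x : ℝ) : HasDerivAt (fun x => gaussianPDFReal 0 1 x * x ^ k)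
      (k * (gaussianPDFReal 0 1 x * x ^ (k - 1)) - gaussianPDFReal 0 1 x * x ^ (k + 1)) x := by
    convert! (hasDerivAt_gaussianPDFReal x).mul (hasDerivAt_pow k x) using 1
    ring
  have h1 := (integrable_gaussianPDFReal_mul_pow (k - 1)).const_mul (k : ℝ)
  have h2 := integrable_gaussianPDFReal_mul_pow (k + 1)
  have := integral_eq_zero_of_hasDerivAt_of_integrable hd (h1.sub h2)
    (integrable_gaussianPDFReal_mul_pow k)
  rw [integral_sub h1 h2, integral_const_mul, ← gaussianMoment_eq, ← gaussianMoment_eq] at this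
  linarith

variable {Ω ι : Type*} [MeasurableSpace Ω] {μ : Measure Ω} {G : ι → Ω → ℝ}

lemma memLp_eval [IsProbabilityMeasure μ] (hG : ∀ i, HasLaw (G i) (gaussianReal 0 1) μ)
    (P : MvPolynomial ι ℂ) {p : ENNReal} (hp : p ≠ ⊤) :
    MemLp (fun ω => MvPolynomial.eval (fun i => (G i ω : ℂ)) P) p μ := by
  induction P using MvPolynomial.induction_on generalizing p with
  | C a => simpa using memLp_const a
  | add P Q hP hQ => simpa using! (hP hp).add (hQ hp)
  | mul_X P i hP =>
    -- Hölder puts both factors in `L^{2p}`, hence the induction over all finite exponents at once.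
    have h2 : 2 * p ≠ ⊤ := ENNReal.mul_ne_top (by simp) hp
    have : ENNReal.HolderTriple (2 * p) (2 * p) p := ⟨by
      rw [ENNReal.mul_inv (by simp) (by simp), ← add_mul, ENNReal.inv_two_add_inv_two, one_mul]⟩
    have hX : MemLp (fun ω => (G i ω : ℂ)) (2 * p) μ := by
      have h := memLp_id_gaussianReal' (μ := 0) (v := 1) (2 * p) h2
      rw [← (hG i).map_eq] at h
      exact (h.comp_of_map (hG i).aemeasurable).ofReal
    simpa using! hX.mul (hP h2)

lemma integrable_eval [IsProbabilityMeasure μ] (hG : ∀ i, HasLaw (G i) (gaussianReal 0 1) μ)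
    (P : MvPolynomial ι ℂ) :
    Integrable (fun ω => MvPolynomial.eval (fun i => (G i ω : ℂ)) P) μ :=
  memLp_one_iff_integrable.1 (memLp_eval hG P (by simp))

/-- Expectation of a polynomial in the random variables `G i`, as a linear functional. -/
noncomputable def polyExpectation [IsProbabilityMeasure μ]
    (hG : ∀ i, HasLaw (G i) (gaussianReal 0 1) μ) : MvPolynomial ι ℂ →ₗ[ℂ] ℂ where
  toFun P := ∫ ω, MvPolynomial.eval (fun i => (G i ω : ℂ)) P ∂μ
  map_add' P Q := by
    simpa using integral_add (integrable_eval hG P) (integrable_eval hG Q)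
  map_smul' c P := by
    simpa using integral_const_mul c _

variable [IsProbabilityMeasure μ] (hG : ∀ i, HasLaw (G i) (gaussianReal 0 1) μ)

lemma polyExpectation_apply (P : MvPolynomial ι ℂ) :
    polyExpectation hG P = ∫ ω, MvPolynomial.eval (fun i => (G i ω : ℂ)) P ∂μ := rfl

lemma polyExpectation_one : polyExpectation hG 1 = 1 := by
  simp [polyExpectation_apply]

lemma polyExpectation_monomial (hind : iIndepFun G μ) (a : ι →₀ ℕ) (r : ℂ) :
    polyExpectation hG (MvPolynomial.monomial a r) =
      r * a.prod fun _ k => (gaussianMoment k : ℂ) := by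
  have hm (i : ι) (k : ℕ) : ∫ ω, (G i ω) ^ k ∂μ = gaussianMoment k :=
    (hG i).integral_comp (f := fun x => x ^ k) (by fun_prop)
  have h := iIndepFun.integral_fun_prod_comp (X := fun i : a.support => G i)
    (f := fun i x => x ^ a i) (hind.precomp Subtype.val_injective)
    (fun i => (hG i).aemeasurable) (fun i => by fun_prop)
  simp only [hm, Finset.prod_coe_sort a.support (fun i => gaussianMoment (a i))] at h
  simp only [polyExpectation_apply, MvPolynomial.eval_monomial, integral_const_mul, Finsupp.prod]
  congr 1
  rw [← Complex.ofReal_prod, ← h, ← integral_complex_ofReal]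
  congr 1 with ω
  rw [Finset.prod_coe_sort a.support (fun i => G i ω ^ a i)]
  push_cast
  rfl

/-- Gaussian integration by parts (Stein's lemma) for polynomials. -/
theorem polyExpectation_X_mul (hind : iIndepFun G μ) (i : ι) (P : MvPolynomial ι ℂ) :
    polyExpectation hG (MvPolynomial.X i * P) = polyExpectation hG (MvPolynomial.pderiv i P) := by
  classical
  induction P using MvPolynomial.induction_on' with
  | add P Q hP hQ => simp only [mul_add, map_add, hP, hQ]
  | monomial a r =>
    -- Both sides agree away from the variable `i`, so isolating its moment reduces the claim to
    -- `gaussianMoment_succ`.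
    have key (b : ι →₀ ℕ) : (b.prod fun _ k => (gaussianMoment k : ℂ)) =
        gaussianMoment (b i) * (b.erase i).prod fun _ k => (gaussianMoment k : ℂ) :=
      (Finsupp.mul_prod_erase' b i _ fun _ => by simp).symm
    have e1 : (a + Finsupp.single i 1).erase i = a.erase i := by
      ext j; by_cases h : j = i <;> simp [Finsupp.erase, h]
    have e2 : (a - Finsupp.single i 1).erase i = a.erase i := by
      ext j; by_cases h : j = i <;> simp [Finsupp.erase, h]
    rw [mul_comm, MvPolynomial.X, MvPolynomial.monomial_mul, MvPolynomial.pderiv_monomial,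
      polyExpectation_monomial hG hind, polyExpectation_monomial hG hind, key, e1,
      key (a - _), e2]
    simp only [Finsupp.coe_add, Pi.add_apply, Finsupp.single_eq_same, Finsupp.coe_tsub,
      Pi.sub_apply, gaussianMoment_succ]
    push_cast
    ring

end Gaussian

/-! ### Sums over the ways of splitting a word at a letter -/

section SplitSum

variable {α β : Type*} [AddCommMonoid α] [AddCommMonoid β]

/-- The sum of `g u v` over all decompositions `w = u ++ [!s] ++ v`. -/
def splitSum (s : Bool) : List Bool → (List Bool → List Bool → α) → α
  | [], _ => 0
  | b :: w, g => (if b = !s then g [] w else 0) + splitSum s w fun u v => g (b :: u) v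

/-- The sum of `g L'` over all `L'` that arise from `L` by replacing one word `u ++ [!s] ++ v`
of `L` by `w ++ v ++ u`. -/
def mergeSum (s : Bool) (w : List Bool) :
    List (List Bool) → (List (List Bool) → α) → α
  | [], _ => 0
  | x :: L, g => splitSum s x (fun u v => g ((w ++ v ++ u) :: L)) +
      mergeSum s w L fun L' => g (x :: L')

lemma map_splitSum {F : Type*} [FunLike F α β] [AddMonoidHomClass F α β] (φ : F) (s : Bool)
    (w : List Bool) (g : List Bool → List Bool → α) :
    φ (splitSum s w g) = splitSum s w fun u v => φ (g u v) := by
  induction w generalizing g with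
  | nil => simp [splitSum]
  | cons b w ih => simp [splitSum, ih, apply_ite φ]

lemma map_mergeSum {F : Type*} [FunLike F α β] [AddMonoidHomClass F α β] (φ : F) (s : Bool)
    (w : List Bool) (L : List (List Bool)) (g : List (List Bool) → α) :
    φ (mergeSum s w L g) = mergeSum s w L fun L' => φ (g L') := by
  induction L generalizing g with
  | nil => simp [mergeSum]
  | cons x L ih => simp [mergeSum, ih, map_splitSum]

lemma sum_splitSum {κ : Type*} (t : Finset κ) (s : Bool) (w : List Bool)
    (g : κ → List Bool → List Bool → α) :
    ∑ l ∈ t, splitSum s w (g l) = splitSum s w fun u v => ∑ l ∈ t, g l u v := by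
  induction w generalizing g with
  | nil => simp [splitSum]
  | cons b w ih => simp [splitSum, Finset.sum_add_distrib, ih]

lemma mul_splitSum {R : Type*} [Semiring R] (r : R) (s : Bool) (w : List Bool)
    (g : List Bool → List Bool → R) :
    r * splitSum s w g = splitSum s w fun u v => r * g u v :=
  map_splitSum (AddMonoidHom.mulLeft r) s w g

lemma mul_mergeSum {R : Type*} [Semiring R] (r : R) (s : Bool) (w : List Bool)
    (L : List (List Bool)) (g : List (List Bool) → R) :
    r * mergeSum s w L g = mergeSum s w L fun L' => r * g L' :=
  map_mergeSum (AddMonoidHom.mulLeft r) s w L g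

lemma smul_splitSum {S : Type*} [Monoid S] [DistribMulAction S α] (r : S) (s : Bool)
    (w : List Bool) (g : List Bool → List Bool → α) :
    r • splitSum s w g = splitSum s w fun u v => r • g u v :=
  map_splitSum (DistribSMul.toAddMonoidHom α r) s w g

lemma tendsto_splitSum [TopologicalSpace α] [ContinuousAdd α] {s : Bool} {w : List Bool}
    {f : ℕ → List Bool → List Bool → α} {g : List Bool → List Bool → α}
    (h : ∀ u v, u.length + v.length + 1 = w.length →
      Tendsto (fun n => f n u v) atTop (𝓝 (g u v))) :
    Tendsto (fun n => splitSum s w (f n)) atTop (𝓝 (splitSum s w g)) := by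
  induction w generalizing f g with
  | nil => exact tendsto_const_nhds
  | cons b w ih =>
    refine Tendsto.add ?_ (ih fun u v huv => h _ _ (by simp; omega))
    split_ifs
    · exact h [] w (by simp)
    · exact tendsto_const_nhds

/-- The complexity of a list of words that decreases along the Schwinger-Dyson recursion. -/
def wordsSize (L : List (List Bool)) : ℕ := (L.map fun w => w.length + 1).sum

/-- Existence of a limit suffices, since the merging terms carry a factor `1/n²`. -/
lemma exists_tendsto_mergeSum [TopologicalSpace α] [ContinuousAdd α] {s : Bool} {w : List Bool}
    {L : List (List Bool)} {f : ℕ → List (List Bool) → α}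
    (h : ∀ L', wordsSize L' ≤ wordsSize L + w.length →
      ∃ a, Tendsto (fun n => f n L') atTop (𝓝 a)) :
    ∃ a, Tendsto (fun n => mergeSum s w L (f n)) atTop (𝓝 a) := by
  induction L generalizing f with
  | nil => exact ⟨0, tendsto_const_nhds⟩
  | cons x L ih =>
    obtain ⟨a, ha⟩ := ih (f := fun n L' => f n (x :: L')) fun L' hL' => h _ (by
      simp [wordsSize] at hL' ⊢; omega)
    -- With the length condition inside the existential, `choose` yields a limit defined for all
    -- `u`, `v`.
    have h1 (u v : List Bool) : ∃ b, u.length + v.length + 1 = x.length →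
        Tendsto (fun n => f n ((w ++ v ++ u) :: L)) atTop (𝓝 b) := by
      by_cases huv : u.length + v.length + 1 = x.length
      · obtain ⟨b, hb⟩ := h ((w ++ v ++ u) :: L) (by simp [wordsSize]; omega)
        exact ⟨b, fun _ => hb⟩
      · exact ⟨0, fun h => absurd h huv⟩
    choose b hb using h1
    exact ⟨_, (tendsto_splitSum hb).add ha⟩

end SplitSum

/-! ### The Schwinger-Dyson recursion -/

section SchwingerDyson

variable {R : Type*} [CommRing R] [Algebra ℂ R] {n : ℕ}

/-- The product of the matrices `M b` over the letters `b` of a word. -/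
def wordMatrix (M : Bool → Matrix (Fin n) (Fin n) R) (w : List Bool) : Matrix (Fin n) (Fin n) R :=
  (w.map M).prod

/-- The normalized trace of the matrix of a word. -/
noncomputable def wordTrace (M : Bool → Matrix (Fin n) (Fin n) R) (w : List Bool) : R :=
  (1 / n : ℂ) • (wordMatrix M w).trace

/-- The product of the normalized traces of a list of words. -/
noncomputable def tracesProd (M : Bool → Matrix (Fin n) (Fin n) R) (L : List (List Bool)) : R :=
  (L.map (wordTrace M)).prod

variable {M : Bool → Matrix (Fin n) (Fin n) R}

omit [Algebra ℂ R] in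
lemma wordMatrix_append (u v : List Bool) :
    wordMatrix M (u ++ v) = wordMatrix M u * wordMatrix M v := by
  simp [wordMatrix]

lemma tracesProd_cons (w : List Bool) (L : List (List Bool)) :
    tracesProd M (w :: L) = wordTrace M w * tracesProd M L := by
  simp [tracesProd]

lemma wordTrace_nil (hn : n ≠ 0) : wordTrace M [] = 1 := by
  have : ((n : ℕ) : R) = (n : ℂ) • (1 : R) := by
    rw [← Algebra.algebraMap_eq_smul_one, map_natCast]
  rw [wordTrace, wordMatrix, List.map_nil, List.prod_nil, Matrix.trace_one, Fintype.card_fin,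
    this, smul_smul, one_div, inv_mul_cancel₀ (by exact_mod_cast hn), one_smul]

/-- A linear functional `E` with an integration by parts formula: the derivation `D s j k` is
dual to multiplication by the entry `M s j k`, and `M true`, `M false` behave like a complex
Ginibre matrix and its conjugate transpose. -/
structure IsGinibreFunctional (M : Bool → Matrix (Fin n) (Fin n) R) (E : R →ₗ[ℂ] ℂ)
    (D : Bool → Fin n → Fin n → Derivation ℂ R R) : Prop where
  by_parts : ∀ s j k r, E (M s j k * r) = E (D s j k r)
  deriv_self : ∀ s j k l m, D s j k (M s l m) = 0
  deriv_not : ∀ s j k l m, D s j k (M (!s) l m) =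
    if l = k ∧ m = j then (1 / n : ℂ) • (1 : R) else 0

variable {E : R →ₗ[ℂ] ℂ} {D : Bool → Fin n → Fin n → Derivation ℂ R R}

/-- By Leibniz, each letter `!s` is replaced in turn by `1/n` times the matrix unit at `(k, j)`,
which cuts the word there. -/
lemma IsGinibreFunctional.deriv_wordMatrix (h : IsGinibreFunctional M E D) (s : Bool)
    (j k : Fin n) (w : List Bool) (i m : Fin n) :
    D s j k (wordMatrix M w i m) = splitSum s w fun u v =>
      (1 / n : ℂ) • (wordMatrix M u i k * wordMatrix M v j m) := by
  induction w generalizing i with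
  | nil =>
    by_cases him : i = m <;> simp [wordMatrix, splitSum, him]
  | cons b w ih =>
    have hc (u : List Bool) : wordMatrix M (b :: u) = M b * wordMatrix M u := by
      simp [wordMatrix]
    have h0 : wordMatrix M [] = 1 := by simp [wordMatrix]
    simp only [splitSum, hc, Matrix.mul_apply, map_sum, Derivation.leibniz, ih, smul_eq_mul,
      Finset.sum_add_distrib, mul_splitSum, sum_splitSum, h0]
    rw [add_comm]
    congr 1
    · split_ifs with hb
      · subst hb
        simp only [h.deriv_not, Matrix.one_apply]
        by_cases hik : i = k <;> simp [hik]
      · have : b = s := by cases b <;> cases s <;> simp_all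
        subst this
        simp [h.deriv_self]
    · congr with u v
      simp only [Finset.sum_mul, Finset.smul_sum, mul_smul_comm, mul_assoc]

lemma IsGinibreFunctional.deriv_wordTrace (h : IsGinibreFunctional M E D) (s : Bool)
    (j k : Fin n) (w : List Bool) :
    D s j k (wordTrace M w) = splitSum s w fun u v =>
      ((1 / n : ℂ) ^ 2) • wordMatrix M (v ++ u) j k := by
  simp only [wordTrace, Matrix.trace, Matrix.diag_apply, Derivation.map_smul, map_sum,
    h.deriv_wordMatrix, sum_splitSum, smul_splitSum, wordMatrix_append, Matrix.mul_apply,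
    Finset.smul_sum, smul_smul, sq, mul_comm (wordMatrix M _ _ k)]

/-- Contracting `w` with `v ++ u` closes up a single trace. Of the three factors `1/n`, one
normalizes it and two remain. -/
lemma IsGinibreFunctional.sum_deriv_tracesProd (h : IsGinibreFunctional M E D) (s : Bool)
    (w : List Bool) (L : List (List Bool)) :
    ∑ j, ∑ k, (1 / n : ℂ) • (wordMatrix M w k j * D s j k (tracesProd M L)) =
      ((1 / n : ℂ) ^ 2) • mergeSum s w L (tracesProd M) := by
  induction L with
  | nil => simp [tracesProd, mergeSum]
  | cons x L ih =>
    have h1 : ∑ j, ∑ k, (1 / n : ℂ) • (wordMatrix M w k j *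
        (tracesProd M L * D s j k (wordTrace M x))) = ((1 / n : ℂ) ^ 2) •
        splitSum s x (fun u v => tracesProd M ((w ++ v ++ u) :: L)) := by
      simp only [h.deriv_wordTrace, mul_splitSum, smul_splitSum, sum_splitSum]
      congr with u v
      rw [tracesProd_cons, wordTrace, List.append_assoc, wordMatrix_append w, Matrix.trace,
        Finset.sum_comm]
      simp only [Matrix.diag_apply, Matrix.mul_apply, Finset.smul_sum, Finset.sum_mul]
      refine Finset.sum_congr rfl fun k _ => Finset.sum_congr rfl fun j _ => ?_
      simp only [mul_smul_comm, smul_mul_assoc, smul_smul]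
      rw [mul_comm (1 / n : ℂ)]
      congr 1
      ring
    have h2 : ∑ j, ∑ k, (1 / n : ℂ) • (wordMatrix M w k j *
        (wordTrace M x * D s j k (tracesProd M L))) = ((1 / n : ℂ) ^ 2) •
        mergeSum s w L (fun L' => tracesProd M (x :: L')) := by
      have := congrArg (wordTrace M x * ·) ih
      simp only [Finset.mul_sum, mul_smul_comm, mul_mergeSum, ← tracesProd_cons] at this
      rw [← this]
      refine Finset.sum_congr rfl fun k _ => Finset.sum_congr rfl fun j _ => ?_
      rw [mul_left_comm]
    simp only [tracesProd_cons, Derivation.leibniz, smul_eq_mul, mul_add, smul_add,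
      Finset.sum_add_distrib, h1, h2, mergeSum]
    rw [add_comm]

/-- The Schwinger-Dyson equation for mixed traces. -/
theorem IsGinibreFunctional.schwinger_dyson (h : IsGinibreFunctional M E D) (s : Bool)
    (w : List Bool) (L : List (List Bool)) :
    E (tracesProd M ((s :: w) :: L)) =
      splitSum s w (fun u v => E (tracesProd M (u :: v :: L))) +
        (1 / n : ℂ) ^ 2 * mergeSum s w L fun L' => E (tracesProd M L') := by
  have h1 : E (tracesProd M ((s :: w) :: L)) = ∑ j, ∑ k, (1 / n : ℂ) *
      E (M s j k * (wordMatrix M w k j * tracesProd M L)) := by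
    have hc : wordMatrix M (s :: w) = M s * wordMatrix M w := by simp [wordMatrix]
    simp only [tracesProd_cons, wordTrace, hc, Matrix.trace, Matrix.diag_apply, Matrix.mul_apply,
      smul_mul_assoc, Finset.sum_mul, map_smul, map_sum, smul_eq_mul, Finset.mul_sum, mul_assoc]
  have h2 : E (tracesProd M ((s :: w) :: L)) = E (∑ j, ∑ k, ((1 / n : ℂ) •
        (tracesProd M L * D s j k (wordMatrix M w k j)) +
      (1 / n : ℂ) • (wordMatrix M w k j * D s j k (tracesProd M L)))) := by
    rw [h1]
    simp only [h.by_parts, Derivation.leibniz, map_sum, map_add, map_smul, smul_eq_mul, mul_add]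
    simp only [add_comm]
  rw [h2]
  simp only [Finset.sum_add_distrib, h.sum_deriv_tracesProd, map_add, map_smul, smul_eq_mul,
    map_mergeSum]
  congr 1
  -- Differentiating the entry `(k, j)` gives `u k k * v j j`, so the double sum factors into two
  -- traces, and the two factors `1/n` normalize them.
  simp only [h.deriv_wordMatrix, mul_splitSum, smul_splitSum, sum_splitSum, map_splitSum]
  congr with u v
  congr 1
  simp only [tracesProd_cons, wordTrace, Matrix.trace, Matrix.diag_apply, Finset.smul_sum,
    Finset.sum_mul, Finset.mul_sum]
  refine Finset.sum_congr rfl fun k _ => Finset.sum_congr rfl fun j _ => ?_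
  simp only [mul_smul_comm, smul_mul_assoc, smul_smul]
  congr 1
  ring

end SchwingerDyson

/-! ### Passing to the limit in the recursion -/

/-- Solutions of the Schwinger-Dyson recursion factorize asymptotically. -/
theorem tendsto_of_recursion {F : ℕ → List (List Bool) → ℂ} {m : List Bool → ℕ}
    (hF_nil : ∀ n, F n [] = 1) (hF_cons_nil : ∀ n ≠ 0, ∀ L, F n ([] :: L) = F n L)
    (hF : ∀ n s w L, F n ((s :: w) :: L) = splitSum s w (fun u v => F n (u :: v :: L)) +
      (1 / n : ℂ) ^ 2 * mergeSum s w L (F n))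
    (hm_nil : m [] = 1) (hm : ∀ s w, m (s :: w) = splitSum s w fun u v => m u * m v)
    (L : List (List Bool)) :
    Tendsto (fun n => F n L) atTop (𝓝 ((L.map m).prod : ℕ)) := by
  induction hN : wordsSize L using Nat.strong_induction_on generalizing L with
  | _ N ih =>
  subst hN
  match L with
  | [] => simp [hF_nil]
  | [] :: L =>
    have := ih _ (by simp [wordsSize]) L rfl
    simp only [List.map_cons, List.prod_cons, hm_nil, one_mul]
    -- At `n = 0` the empty word has trace `0`, not `1`.
    refine this.congr' ?_
    filter_upwards [eventually_ne_atTop 0] with n hn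
    rw [hF_cons_nil n hn]
  | (s :: w) :: L =>
    simp only [hF]
    have h0 : Tendsto (fun n : ℕ => (1 / n : ℂ) ^ 2) atTop (𝓝 0) := by
      simpa using (tendsto_one_div_atTop_nhds_zero_nat (𝕜 := ℂ)).pow 2
    obtain ⟨a, ha⟩ := exists_tendsto_mergeSum (s := s) (w := w) (L := L) (f := F)
      fun L' hL' => ⟨_, ih _ (by simp [wordsSize] at hL' ⊢; omega) L' rfl⟩
    -- Splitting loses two letters and gains one word, so `wordsSize` drops by one.
    have h1 := tendsto_splitSum (s := s) (w := w) (f := fun n u v => F n (u :: v :: L))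
      (g := fun u v => (((u :: v :: L).map m).prod : ℕ))
      fun u v huv => ih _ (by simp [wordsSize]; omega) (u :: v :: L) rfl
    convert! h1.add (h0.mul ha) using 2
    rw [zero_mul, add_zero, List.map_cons, List.prod_cons, hm, mul_comm, mul_splitSum]
    rw [← Nat.coe_castAddMonoidHom, map_splitSum]
    congr with u v
    simp
    ring

/-! ### Counting non-crossing matchings -/

section Counting

/-- `f` restricts to a non-crossing matching of the vertices in `[a, b)` whose edges join opposite
spins, and fixes all other natural numbers. -/
structure IsNCMatchingOn (σ : ℕ → Bool) (a b : ℕ) (f : ℕ → ℕ) : Prop where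
  eq_self : ∀ i, i < a ∨ b ≤ i → f i = i
  matching : ∀ i, a ≤ i → i < b → a ≤ f i ∧ f i < b ∧ f i ≠ i ∧ f (f i) = i ∧ σ (f i) = !σ i
  noncrossing : ∀ i j, i < j → j < f i → f i < f j → False

variable {σ : ℕ → Bool} {a b c : ℕ} {f g h : ℕ → ℕ}

lemma IsNCMatchingOn.lt (hf : IsNCMatchingOn σ a b f) {i : ℕ} (hi : i < b) : f i < b := by
  by_cases h : a ≤ i
  · exact (hf.matching i h hi).2.1
  · rw [hf.eq_self i (by omega)]; exact hi

lemma IsNCMatchingOn.apply_apply (hf : IsNCMatchingOn σ a b f) (i : ℕ) : f (f i) = i := by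
  by_cases h : a ≤ i ∧ i < b
  · exact (hf.matching i h.1 h.2).2.2.2.1
  · rw [hf.eq_self i (by omega), hf.eq_self i (by omega)]

instance finite_ncMatchingOn (σ : ℕ → Bool) (a b : ℕ) : Finite {f // IsNCMatchingOn σ a b f} := by
  refine Finite.of_injective (β := Fin b → Fin b) (fun f i => ⟨f.1 i, f.2.lt i.2⟩) ?_
  intro f g hfg
  ext i
  by_cases hi : i < b
  · simpa using congrFun hfg ⟨i, hi⟩
  · rw [f.2.eq_self i (by omega), g.2.eq_self i (by omega)]

/-- Leaving the interval would cross the edge `{a, c}`, whose endpoints are already taken. -/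
lemma IsNCMatchingOn.inside (hf : IsNCMatchingOn σ a b f) (hab : a < b) (hac : f a = c) {i : ℕ}
    (h1 : a < i) (h2 : i < c) : a < f i ∧ f i < c := by
  have hc := (hf.matching a le_rfl hab).2.1
  have hi := hf.matching i (by omega) (by omega)
  have ha := hf.apply_apply a
  have hcr : ¬ f a < f i := hf.noncrossing a i h1 (by omega)
  rw [hac] at ha hcr
  have n1 : f i ≠ a := fun h => by have := hf.apply_apply i; rw [h] at this; omega
  have n2 : f i ≠ c := fun h => by have := hf.apply_apply i; rw [h] at this; omega
  omega

lemma IsNCMatchingOn.outside (hf : IsNCMatchingOn σ a b f) (hab : a < b) (hac : f a = c) {i : ℕ}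
    (h1 : c < i) (h2 : i < b) : c < f i := by
  have hc := hf.matching a le_rfl hab
  have hi := hf.matching i (by omega) (by omega)
  have ha := hf.apply_apply a
  rw [hac] at ha
  have n1 : f i ≠ a := fun h => by have := hf.apply_apply i; rw [h] at this; omega
  have n2 : f i ≠ c := fun h => by have := hf.apply_apply i; rw [h] at this; omega
  by_contra hlt
  have := hf.inside hab hac (i := f i) (by omega) (by omega)
  rw [hf.apply_apply] at this
  omega

/-- Restriction of a map to `[x, y)`, extended by the identity. -/
def restrictTo (x y : ℕ) (f : ℕ → ℕ) (i : ℕ) : ℕ := if x ≤ i ∧ i < y then f i else i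

lemma restrictTo_of_mem {x y i : ℕ} (h : x ≤ i ∧ i < y) : restrictTo x y f i = f i := if_pos h

lemma restrictTo_of_not_mem {x y i : ℕ} (h : ¬ (x ≤ i ∧ i < y)) : restrictTo x y f i = i :=
  if_neg h

lemma IsNCMatchingOn.restrictTo {x y : ℕ} (hf : IsNCMatchingOn σ a b f) (hx : a ≤ x) (hy : y ≤ b)
    (hxy : ∀ i, x ≤ i → i < y → x ≤ f i ∧ f i < y) :
    IsNCMatchingOn σ x y (restrictTo x y f) where
  eq_self i hi := restrictTo_of_not_mem (by omega)
  matching i h1 h2 := by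
    rw [restrictTo_of_mem ⟨h1, h2⟩, restrictTo_of_mem (hxy i h1 h2)]
    exact ⟨(hxy i h1 h2).1, (hxy i h1 h2).2, (hf.matching i (by omega) (by omega)).2.2⟩
  noncrossing i j := by
    have := hf.noncrossing i j
    have := hxy i
    have := hxy j
    unfold Ginibre.restrictTo
    split_ifs <;> omega

/-- Join the vertices `a` and `c` by an edge, and use `g` inside of it and `h` outside of it. -/
def glue (a c : ℕ) (g h : ℕ → ℕ) (i : ℕ) : ℕ :=
  if i = a then c else if i = c then a else if i < c then g i else h i

/-- The edges of `g` lie strictly between `a` and `c` and those of `h` beyond `c`, so no new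
crossing can arise. -/
lemma isNCMatchingOn_glue (hac : a < c) (hcb : c < b) (hσ : σ c = !σ a)
    (hg : IsNCMatchingOn σ (a + 1) c g) (hh : IsNCMatchingOn σ (c + 1) b h) :
    IsNCMatchingOn σ a b (glue a c g h) where
  eq_self i hi := by
    have := hg.eq_self i
    have := hh.eq_self i
    unfold glue
    split_ifs <;> omega
  matching i h1 h2 := by
    by_cases e1 : i = a
    · subst e1
      have : c ≠ i := by omega
      simp [glue, this, hσ]
      omega
    by_cases e2 : i = c
    · subst e2
      simp [glue, e1, hσ]
      omega
    by_cases e3 : i < c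
    · have := hg.matching i (by omega) e3
      have n1 : g i ≠ a := by omega
      have n2 : g i ≠ c := by omega
      simp [glue, e1, e2, e3, n1, n2, this]
      omega
    · have := hh.matching i (by omega) h2
      have n1 : h i ≠ a := by omega
      have n2 : h i ≠ c := by omega
      have n3 : ¬ h i < c := by omega
      simp [glue, e1, e2, e3, n1, n2, n3, this]
      omega
  noncrossing i j := by
    have := hg.noncrossing i j
    have := hh.noncrossing i j
    have := hg.eq_self i
    have := hh.eq_self i
    have := hg.eq_self j
    have := hh.eq_self j
    have := hg.matching i
    have := hh.matching i
    have := hg.matching j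
    have := hh.matching j
    unfold glue
    split_ifs <;> omega

/-- Matchings in which the first vertex `a` is joined to `c` correspond to pairs of matchings of
the vertices on both sides of this edge. -/
def fiberEquiv (hac : a < c) (hcb : c < b) (hσ : σ c = !σ a) :
    {f // IsNCMatchingOn σ a b f ∧ f a = c} ≃
      {g // IsNCMatchingOn σ (a + 1) c g} × {h // IsNCMatchingOn σ (c + 1) b h} where
  toFun f := ⟨⟨restrictTo (a + 1) c f.1, f.2.1.restrictTo (by omega) (by omega) fun i h1 h2 =>
      f.2.1.inside (by omega) f.2.2 (by omega) (by omega)⟩,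
    ⟨restrictTo (c + 1) b f.1, f.2.1.restrictTo (by omega) le_rfl fun i h1 h2 =>
      ⟨f.2.1.outside (by omega) f.2.2 (by omega) h2, f.2.1.lt h2⟩⟩⟩
  invFun x := ⟨glue a c x.1.1 x.2.1, isNCMatchingOn_glue hac hcb hσ x.1.2 x.2.2, by simp [glue]⟩
  left_inv f := by
    obtain ⟨f, hf, hfa⟩ := f
    have h1 := hf.apply_apply a
    rw [hfa] at h1
    ext i
    have := hf.eq_self i
    simp only [glue, restrictTo]
    split_ifs <;> subst_vars <;> omega
  right_inv x := by
    obtain ⟨⟨g, hg⟩, ⟨h, hh⟩⟩ := x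
    ext i
    · have := hg.eq_self i
      simp only [glue, restrictTo]
      split_ifs <;> omega
    · have := hh.eq_self i
      simp only [glue, restrictTo]
      split_ifs <;> omega

/-- The number of spin-reversing non-crossing matchings of the `l` vertices `a, …, a + l - 1`. -/
noncomputable def numMatchings (σ : ℕ → Bool) (a l : ℕ) : ℕ :=
  Nat.card {f // IsNCMatchingOn σ a (a + l) f}

lemma numMatchings_zero (σ : ℕ → Bool) (a : ℕ) : numMatchings σ a 0 = 1 := by
  rw [numMatchings, Nat.card_eq_one_iff_unique]
  refine ⟨⟨fun f g => ?_⟩, ⟨id, fun _ _ => rfl, fun i h1 h2 => by omega, fun i j => ?_⟩⟩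
  · ext i
    rw [f.2.eq_self i (by omega), g.2.eq_self i (by omega)]
  · simp only [id]; omega

/-- Catalan-type recursion: sort by the partner `a + 1 + c` of `a`, which leaves `c` vertices inside
the edge and `l - c - 1` outside. -/
lemma numMatchings_succ (σ : ℕ → Bool) (a l : ℕ) :
    numMatchings σ a (l + 1) = ∑ c ∈ Finset.range l, if σ (a + 1 + c) = !σ a then
      numMatchings σ (a + 1) c * numMatchings σ (a + 1 + c + 1) (l - c - 1) else 0 := by
  let φ : {f // IsNCMatchingOn σ a (a + (l + 1)) f} → Fin l := fun f => ⟨f.1 a - (a + 1), by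
    have := f.2.matching a le_rfl (by omega); omega⟩
  have hφ (f : {f // IsNCMatchingOn σ a (a + (l + 1)) f}) (c : Fin l) :
      φ f = c ↔ f.1 a = a + 1 + c := by
    have := f.2.matching a le_rfl (by omega)
    simp only [φ, Fin.ext_iff]
    omega
  rw [numMatchings, ← Nat.card_congr (Equiv.sigmaFiberEquiv φ), Nat.card_sigma,
    ← Fin.sum_univ_eq_sum_range (fun c => if σ (a + 1 + c) = !σ a then
      numMatchings σ (a + 1) c * numMatchings σ (a + 1 + c + 1) (l - c - 1) else 0)]
  refine Finset.sum_congr rfl fun c _ => ?_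
  rw [Nat.card_congr ((Equiv.subtypeEquivRight fun f => hφ f c).trans
    (Equiv.subtypeSubtypeEquivSubtypeInter _ (fun f : ℕ → ℕ => f a = a + 1 + c)))]
  split_ifs with hσ
  · have e : a + 1 + c + 1 + (l - c - 1) = a + (l + 1) := by omega
    rw [Nat.card_congr (fiberEquiv (by omega) (by omega) hσ), Nat.card_prod, numMatchings,
      numMatchings, e]
  · rw [Nat.card_eq_zero]
    refine Or.inl ⟨fun ⟨f, hf, hfa⟩ => hσ ?_⟩
    have := (hf.matching a le_rfl (by omega)).2.2.2.2
    rwa [hfa] at this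

/-- Induction through the recursion avoids transporting matchings along a shift. -/
lemma numMatchings_congr {σ' : ℕ → Bool} {a' l : ℕ} (hσ : ∀ i < l, σ (a + i) = σ' (a' + i)) :
    numMatchings σ a l = numMatchings σ' a' l := by
  induction l using Nat.strong_induction_on generalizing a a' with
  | _ l ih =>
  cases l with
  | zero => rw [numMatchings_zero, numMatchings_zero]
  | succ l =>
    rw [numMatchings_succ, numMatchings_succ]
    refine Finset.sum_congr rfl fun c hc => ?_
    have hcl := Finset.mem_range.1 hc
    have h0 := hσ 0 (by omega)
    have h1 := hσ (1 + c) (by omega)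
    rw [add_zero, add_zero] at h0
    rw [← add_assoc, ← add_assoc] at h1
    have e1 : numMatchings σ (a + 1) c = numMatchings σ' (a' + 1) c :=
      ih c (by omega) fun i hi => by simpa only [add_assoc] using hσ (1 + i) (by omega)
    have e2 : numMatchings σ (a + 1 + c + 1) (l - c - 1) =
        numMatchings σ' (a' + 1 + c + 1) (l - c - 1) :=
      ih _ (by omega) fun i hi => by
        simpa only [add_assoc] using hσ (1 + (c + (1 + i))) (by omega)
    rw [h0, h1, e1, e2]

/-- The number of spin-reversing non-crossing matchings of the letters of a word. -/
noncomputable def wordMatchings (w : List Bool) : ℕ :=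
  numMatchings (fun i => w.getD i true) 0 w.length

lemma wordMatchings_nil : wordMatchings [] = 1 := numMatchings_zero _ _

lemma splitSum_eq_sum {α : Type*} [AddCommMonoid α] (s : Bool) (w : List Bool)
    (g : List Bool → List Bool → α) :
    splitSum s w g = ∑ c ∈ Finset.range w.length,
      if w.getD c true = !s then g (w.take c) (w.drop (c + 1)) else 0 := by
  induction w generalizing g with
  | nil => simp [splitSum]
  | cons b w ih =>
    rw [splitSum, ih, List.length_cons, Finset.sum_range_succ', add_comm]
    simp

lemma wordMatchings_cons (s : Bool) (w : List Bool) :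
    wordMatchings (s :: w) = splitSum s w fun u v => wordMatchings u * wordMatchings v := by
  rw [wordMatchings, List.length_cons, numMatchings_succ, splitSum_eq_sum]
  refine Finset.sum_congr rfl fun c hc => ?_
  have hcl := Finset.mem_range.1 hc
  have h1 : (s :: w).getD (0 + 1 + c) true = w.getD c true := by
    rw [zero_add, add_comm, List.getD_cons_succ]
  have h2 : numMatchings (fun i => (s :: w).getD i true) (0 + 1) c = wordMatchings (w.take c) := by
    rw [wordMatchings, List.length_take, min_eq_left hcl.le]
    refine numMatchings_congr fun i hi => ?_
    simp [add_comm 1 i, hi]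
  have h3 : numMatchings (fun i => (s :: w).getD i true) (0 + 1 + c + 1) (w.length - c - 1) =
      wordMatchings (w.drop (c + 1)) := by
    rw [wordMatchings, List.length_drop, Nat.sub_sub]
    refine numMatchings_congr fun i hi => ?_
    have : 0 + 1 + c + 1 + i = (c + 1 + i) + 1 := by omega
    simp [this, List.getElem?_drop]
  rw [h1, h2, h3]
  rfl

/-! ### From matchings of `Fin R` to matchings of words -/

/-- The spin attached to a letter. -/
def spinOf (b : Bool) : ℤ := if b then 1 else -1

lemma spinOf_opposite (b b' : Bool) :
    ((spinOf b = 1 ∧ spinOf b' = -1) ∨ (spinOf b = -1 ∧ spinOf b' = 1)) ↔ b' = !b := by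
  cases b <;> cases b' <;> simp [spinOf]

/-- The bijection extends a map of `Fin R` by the identity to `ℕ`; its inverse restricts. -/
lemma card_matchings_eq_wordMatchings (w : List Bool) :
    Nat.card {f : Fin (w.map spinOf).length → Fin (w.map spinOf).length //
      IsMatching f ∧ IsNonCrossing f ∧ JoinsOppositeSpins (w.map spinOf).get f} =
    wordMatchings w := by
  have hl : (w.map spinOf).length = w.length := List.length_map _
  have hget (i : Fin (w.map spinOf).length) :
      (w.map spinOf).get i = spinOf (w.getD i true) := by
    have : i.1 < w.length := by omega
    simp [this]
  refine Nat.card_congr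
    { toFun := fun f => ⟨fun i => if h : i < (w.map spinOf).length then f.1 ⟨i, h⟩ else i, ?_⟩
      invFun := fun g => ⟨fun i => ⟨g.1 i, ?_⟩, ?_⟩
      left_inv := fun f => ?_
      right_inv := fun g => ?_ }
  · obtain ⟨f, hm, hn, hs⟩ := f
    refine ⟨fun i hi => dif_neg (by omega), fun i _ h2 => ?_, fun i j hij hj hf => ?_⟩
    · have h2 : i < (w.map spinOf).length := by omega
      have h3 := hs ⟨i, h2⟩
      rw [hget, hget, spinOf_opposite] at h3
      have h4 := (f ⟨i, h2⟩).2
      simp only [h2, dite_true, Fin.is_lt, Fin.eta, (hm _).2]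
      refine ⟨Nat.zero_le _, by omega, fun h => (hm ⟨i, h2⟩).1 (Fin.ext h), trivial, h3⟩
    · by_cases h1 : i < (w.map spinOf).length
      · by_cases h2 : j < (w.map spinOf).length
        · simp only [h1, h2, dite_true] at hj hf
          exact hn ⟨i, h1⟩ ⟨j, h2⟩ ⟨hij, hj, hf⟩
        · have := (f ⟨i, h1⟩).2
          simp only [h1, dite_true] at hj
          omega
      · simp only [h1, dite_false] at hj
        omega
  · have := g.2.lt (i := i) (by have := i.2; omega)
    omega
  · obtain ⟨g, hg⟩ := g
    refine ⟨fun i => ?_, fun i j hij => hg.noncrossing i j hij.1 hij.2.1 hij.2.2, fun i => ?_⟩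
    · have := hg.matching i (by omega) (by have := i.2; omega)
      exact ⟨fun h => this.2.2.1 (Fin.ext_iff.1 h), Fin.ext this.2.2.2.1⟩
    · have := hg.matching i (by omega) (by have := i.2; omega)
      rw [hget, hget, spinOf_opposite]
      exact this.2.2.2.2
  · ext i
    simp only [i.2, dite_true, Fin.eta]
  · ext i
    by_cases h : i < (w.map spinOf).length
    · simp only [h, dite_true]
    · simp only [h, dite_false]
      exact (g.2.eq_self i (by omega)).symm

/-- The word in the letters `true` (for `A`) and `false` (for `Aᴴ`) given by `p, q`. -/
def spinWord {k : ℕ} (p q : Fin k → ℕ) : List Bool :=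
  (List.ofFn fun j => List.replicate (p j) true ++ List.replicate (q j) false).flatten

lemma spins_eq_map_spinWord {k : ℕ} (p q : Fin k → ℕ) :
    spins p q = (spinWord p q).map spinOf := by
  simp [spins, spinWord, List.map_flatten, List.map_ofFn, Function.comp_def, spinOf]

lemma limitMoment_eq {k : ℕ} (p q : Fin k → ℕ) :
    limitMoment p q = wordMatchings (spinWord p q) := by
  rw [limitMoment, spins_eq_map_spinWord, card_matchings_eq_wordMatchings]

end Counting

/-! ### The Ginibre ensemble -/

section Ensemble

/-- The polynomial ring in the real and imaginary parts of the matrix entries. -/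
abbrev EntryPoly : Type := MvPolynomial ((ℕ × ℕ) ⊕ (ℕ × ℕ)) ℂ

/-- The Ginibre matrix (`true`) and its conjugate transpose (`false`) as matrices of polynomials
in the real and imaginary parts of the entries. -/
noncomputable def polyMatrix (n : ℕ) : Bool → Matrix (Fin n) (Fin n) EntryPoly
  | true => Matrix.of fun j k => ((Real.sqrt (2 * n) : ℝ) : ℂ)⁻¹ •
      (MvPolynomial.X (Sum.inl (j.1, k.1)) + Complex.I • MvPolynomial.X (Sum.inr (j.1, k.1)))
  | false => Matrix.of fun j k => ((Real.sqrt (2 * n) : ℝ) : ℂ)⁻¹ •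
      (MvPolynomial.X (Sum.inl (k.1, j.1)) - Complex.I • MvPolynomial.X (Sum.inr (k.1, j.1)))

/-- The derivations dual to multiplication by the entries of `polyMatrix`. -/
noncomputable def polyDeriv (n : ℕ) : Bool → Fin n → Fin n → Derivation ℂ EntryPoly EntryPoly
  | true => fun j k => ((Real.sqrt (2 * n) : ℝ) : ℂ)⁻¹ •
      (MvPolynomial.pderiv (Sum.inl (j.1, k.1)) +
        Complex.I • MvPolynomial.pderiv (Sum.inr (j.1, k.1)))
  | false => fun j k => ((Real.sqrt (2 * n) : ℝ) : ℂ)⁻¹ •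
      (MvPolynomial.pderiv (Sum.inl (k.1, j.1)) -
        Complex.I • MvPolynomial.pderiv (Sum.inr (k.1, j.1)))

lemma pderiv_X_inl (i j : ℕ × ℕ) : MvPolynomial.pderiv (Sum.inl i)
    (MvPolynomial.X (Sum.inl j) : EntryPoly) = if j = i then 1 else 0 := by
  rw [MvPolynomial.pderiv_X]
  by_cases h : j = i <;> simp [h]

lemma pderiv_X_inr (i j : ℕ × ℕ) : MvPolynomial.pderiv (Sum.inr i)
    (MvPolynomial.X (Sum.inr j) : EntryPoly) = if j = i then 1 else 0 := by
  rw [MvPolynomial.pderiv_X]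
  by_cases h : j = i <;> simp [h]

lemma pderiv_X_inl_inr (i j : ℕ × ℕ) : MvPolynomial.pderiv (Sum.inl i)
    (MvPolynomial.X (Sum.inr j) : EntryPoly) = 0 :=
  MvPolynomial.pderiv_X_of_ne (by simp)

lemma pderiv_X_inr_inl (i j : ℕ × ℕ) : MvPolynomial.pderiv (Sum.inr i)
    (MvPolynomial.X (Sum.inl j) : EntryPoly) = 0 :=
  MvPolynomial.pderiv_X_of_ne (by simp)

lemma inv_sqrt_mul_inv_sqrt (n : ℕ) :
    ((Real.sqrt (2 * n) : ℝ) : ℂ)⁻¹ * ((Real.sqrt (2 * n) : ℝ) : ℂ)⁻¹ = (1 / 2) * (1 / n) := by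
  rw [← mul_inv, ← Complex.ofReal_mul, Real.mul_self_sqrt (by positivity)]
  push_cast
  rw [mul_inv]
  ring

lemma I_smul_smul_I_smul (r : ℂ) (P : EntryPoly) : Complex.I • r • Complex.I • P = -(r • P) := by
  rw [smul_smul, smul_smul, mul_right_comm, Complex.I_mul_I, neg_one_mul, neg_smul]

/-- Stein's lemma turns multiplication by `x + iy` into `∂x + i∂y`, which kills `x + iy` and sends
`x - iy` to `2`. The scaling `1/(2n)` makes this `1/n`. -/
lemma isGinibreFunctional_polyMatrix {Ω : Type*} [MeasurableSpace Ω] {μ : Measure Ω}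
    [IsProbabilityMeasure μ] {G : (ℕ × ℕ) ⊕ (ℕ × ℕ) → Ω → ℝ}
    (hG : ∀ i, HasLaw (G i) (gaussianReal 0 1) μ) (hind : iIndepFun G μ) (n : ℕ) :
    IsGinibreFunctional (polyMatrix n) (polyExpectation hG) (polyDeriv n) where
  by_parts s j k r := by
    cases s <;>
    simp only [polyMatrix, polyDeriv, Matrix.of_apply, smul_mul_assoc, add_mul, sub_mul, map_smul,
      map_add, map_sub, polyExpectation_X_mul hG hind, Derivation.smul_apply,
      Derivation.add_apply, Derivation.sub_apply]
  deriv_self s j k l m := by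
    cases s <;>
    simp only [polyMatrix, polyDeriv, Matrix.of_apply, Derivation.smul_apply, Derivation.map_smul,
      Derivation.add_apply, Derivation.sub_apply, map_add, map_sub, pderiv_X_inl, pderiv_X_inr,
      pderiv_X_inl_inr, pderiv_X_inr_inl, smul_zero, add_zero, zero_add, sub_zero, zero_sub,
      smul_neg, I_smul_smul_I_smul, add_neg_cancel, sub_self, neg_neg]
  deriv_not s j k l m := by
    have key (c : Prop) [Decidable c] : ((Real.sqrt (2 * n) : ℝ) : ℂ)⁻¹ •
        (((Real.sqrt (2 * n) : ℝ) : ℂ)⁻¹ • ((if c then (1 : EntryPoly) else 0) + if c then 1 else 0)) =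
        if c then (1 / n : ℂ) • (1 : EntryPoly) else 0 := by
      split_ifs
      · rw [smul_smul, inv_sqrt_mul_inv_sqrt, ← two_smul ℂ (1 : EntryPoly), smul_smul]
        congr 1
        ring
      · simp
    have e : ((m : ℕ), (l : ℕ)) = (j.1, k.1) ↔ l = k ∧ m = j := by
      simp [Fin.ext_iff, and_comm]
    have e' : ((l : ℕ), (m : ℕ)) = (k.1, j.1) ↔ l = k ∧ m = j := by
      simp [Fin.ext_iff]
    rw [← key]
    cases s <;>
    simp only [polyMatrix, polyDeriv, Matrix.of_apply, Derivation.smul_apply, Derivation.map_smul,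
      Derivation.add_apply, Derivation.sub_apply, map_add, map_sub, pderiv_X_inl, pderiv_X_inr,
      pderiv_X_inl_inr, pderiv_X_inr_inl, smul_zero, add_zero, zero_add, sub_zero, zero_sub,
      smul_neg, I_smul_smul_I_smul, sub_neg_eq_add, neg_neg, smul_add, Bool.not_true,
      Bool.not_false, e, e']

lemma map_polyMatrix_true (x y : ℕ → ℕ → ℝ) (n : ℕ) :
    (polyMatrix n true).map (MvPolynomial.eval (fun i => ((Sum.elim (fun s : ℕ × ℕ => x s.1 s.2)
      (fun s : ℕ × ℕ => y s.1 s.2) i : ℝ) : ℂ))) = ginibreMatrix x y n := by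
  ext j k
  simp [polyMatrix, ginibreMatrix, div_eq_inv_mul, MvPolynomial.smul_eval]
  ring

lemma map_polyMatrix_false (x y : ℕ → ℕ → ℝ) (n : ℕ) :
    (polyMatrix n false).map (MvPolynomial.eval (fun i => ((Sum.elim (fun s : ℕ × ℕ => x s.1 s.2)
      (fun s : ℕ × ℕ => y s.1 s.2) i : ℝ) : ℂ))) = (ginibreMatrix x y n)ᴴ := by
  ext j k
  simp [polyMatrix, ginibreMatrix, div_eq_inv_mul, MvPolynomial.smul_eval]
  exact Or.inl (by ring)

lemma eval_wordTrace {n k : ℕ} (x y : ℕ → ℕ → ℝ) (p q : Fin k → ℕ) :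
    MvPolynomial.eval (fun i => ((Sum.elim (fun s : ℕ × ℕ => x s.1 s.2)
      (fun s : ℕ × ℕ => y s.1 s.2) i : ℝ) : ℂ)) (wordTrace (polyMatrix n) (spinWord p q)) =
    mixedTrace (ginibreMatrix x y n) p q := by
  rw [wordTrace, MvPolynomial.smul_eval, mixedTrace, AddMonoidHom.map_trace]
  congr 2
  change ((MvPolynomial.eval _).mapMatrix (wordMatrix (polyMatrix n) (spinWord p q))) = _
  rw [wordMatrix, map_list_prod, List.map_map, spinWord, List.map_flatten, List.prod_flatten,
    List.map_map, List.map_ofFn]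
  congr 2
  funext j
  simp [map_polyMatrix_true, map_polyMatrix_false]

end Ensemble

end Ginibre

theorem theorem2p1 {Ω : Type*} [MeasurableSpace Ω] (μ : Measure Ω) [IsProbabilityMeasure μ]
    (X Y : ℕ → ℕ → Ω → ℝ) (hXY : Ginibre.IsIIDStandardGaussian X Y μ)
    (k : ℕ) (p q : Fin k → ℕ) :
    (∀ n : ℕ, Integrable (fun ω => Ginibre.mixedTrace
      (Ginibre.ginibreMatrix (fun i j => X i j ω) (fun i j => Y i j ω) n) p q) μ) ∧
    Tendsto (fun n : ℕ => ∫ ω, Ginibre.mixedTrace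
      (Ginibre.ginibreMatrix (fun i j => X i j ω) (fun i j => Y i j ω) n) p q ∂μ)
      atTop (𝓝 (Ginibre.limitMoment p q : ℂ)) := by
  let G : (ℕ × ℕ) ⊕ (ℕ × ℕ) → Ω → ℝ :=
    Sum.elim (fun s : ℕ × ℕ => X s.1 s.2) (fun s : ℕ × ℕ => Y s.1 s.2)
  have hG : ∀ i, HasLaw (G i) (gaussianReal 0 1) μ := by
    rintro (i | i)
    · exact hXY.law_X i.1 i.2
    · exact hXY.law_Y i.1 i.2
  have hGω (ω : Ω) : (fun i => (G i ω : ℂ)) = fun i =>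
      ((Sum.elim (fun s : ℕ × ℕ => X s.1 s.2 ω) (fun s : ℕ × ℕ => Y s.1 s.2 ω) i : ℝ) : ℂ) := by
    funext i
    cases i <;> rfl
  have heval (n : ℕ) (ω : Ω) : Ginibre.mixedTrace
      (Ginibre.ginibreMatrix (fun i j => X i j ω) (fun i j => Y i j ω) n) p q =
      MvPolynomial.eval (fun i => (G i ω : ℂ))
        (Ginibre.wordTrace (Ginibre.polyMatrix n) (Ginibre.spinWord p q)) := by
    rw [hGω]
    exact (Ginibre.eval_wordTrace _ _ p q).symm
  simp only [heval]
  refine ⟨fun n => Ginibre.integrable_eval hG _, ?_⟩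
  have h := Ginibre.tendsto_of_recursion
    (F := fun n L => Ginibre.polyExpectation hG (Ginibre.tracesProd (Ginibre.polyMatrix n) L))
    (fun n => by simp [Ginibre.tracesProd, Ginibre.polyExpectation_one])
    (fun n hn L => by simp only [Ginibre.tracesProd_cons, Ginibre.wordTrace_nil hn, one_mul])
    (fun n => (Ginibre.isGinibreFunctional_polyMatrix hG hXY.indep n).schwinger_dyson)
    -- The mixed trace is the case of a single word.
    Ginibre.wordMatchings_nil Ginibre.wordMatchings_cons [Ginibre.spinWord p q]
  simpa [Ginibre.tracesProd, Ginibre.limitMoment_eq, Ginibre.polyExpectation_apply] using h
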